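/- For every even integer $k \ge 4$ there is a constant $c > 0$ (depending only on $k$) such that the following holds for every integer $n \ge 1$. Let $\mathcal{H}$ be a $k$-graph on $n$ vertices, that is, a vertex set $V$ with $|V| = n$ together with a set $E(\mathcal{H})$ of $k$-element subsets of $V$, called edges. If $|e_1 \cap e_2| \notin \{0, k/2\}$ for any two distinct edges $e_1, e_2 \in E(\mathcal{H})$, then $$|E(\mathcal{H})| < c\, n^{k/2-1}.$$ -/

import Mathlib

/-- `H` is a `k`-graph (`k`-uniform hypergraph): every edge consists of exactly `k` vertices. -/
def Hypergraph.IsKGraph {α : Type*} (H : Hypergraph α) (k : ℕ) : Prop :=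
  ∀ e ∈ H.edgeSet, e.encard = k

-- Write `k = 2m`. A suitable colouring with `k` colours keeps a constant proportion of the edges
-- rainbow. Rainbow edges are words of length `2m` over the vertices, and intersection sizes become
-- sizes of agreement sets.
--
-- Induct on the family `𝒥` of allowed agreement sets. If `A, B ∈ 𝒥` but `A ∩ B ∉ 𝒥`, no word is
-- full for both, so the words split into boundedly many classes, each losing `A` or `B` from `𝒥`.
-- If `𝒥` is closed under intersection, the Frankl–Katona theorem gives `m - 1` coordinates
-- contained in no member of `𝒥`. They determine the word, which leaves at most `n ^ (m - 1)` words.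

universe u

/-! ### The Frankl–Katona theorem -/

open Finset in
/-- In a bipartite relation between `A` and a smaller set `B` in which no element of `A` is
isolated, some related pair `i`, `b` has the degree of `b` larger than that of `i`. -/
theorem exists_card_filter_lt_card_filter {ι β : Type*} (r : ι → β → Prop)
    [∀ i b, Decidable (r i b)] (A : Finset ι) (B : Finset β) (h : #B < #A)
    (hne : ∀ i ∈ A, ∃ b ∈ B, r i b) :
    ∃ i ∈ A, ∃ b ∈ B, r i b ∧ #{b ∈ B | r i b} < #{i ∈ A | r i b} := by
  by_contra! hcon
  -- Weight each related pair by the inverse degree of one end: the total is `#A` from the `A` side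
  -- and at most `#B` from the other.
  have h1 : ∀ i ∈ A, ∑ b ∈ B with r i b, (#{b ∈ B | r i b} : ℚ)⁻¹ = 1 := by
    intro i hi
    obtain ⟨b, hb, hib⟩ := hne i hi
    have : 0 < #{b ∈ B | r i b} := card_pos.2 ⟨b, by simp [hb, hib]⟩
    rw [sum_const, nsmul_eq_mul, mul_inv_cancel₀ (by positivity)]
  have h2 : ∀ b ∈ B, ∑ i ∈ A with r i b, (#{i ∈ A | r i b} : ℚ)⁻¹ ≤ 1 := by
    intro b _
    rw [sum_const, nsmul_eq_mul]
    exact mul_inv_le_one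
  have h3 : (#A : ℚ) ≤ #B := by
    calc (#A : ℚ) = ∑ i ∈ A, ∑ b ∈ B with r i b, (#{b ∈ B | r i b} : ℚ)⁻¹ := by
          rw [sum_congr rfl h1]; simp
      _ ≤ ∑ i ∈ A, ∑ b ∈ B with r i b, (#{i ∈ A | r i b} : ℚ)⁻¹ := by
          refine sum_le_sum fun i hi => sum_le_sum fun b hb => ?_
          rw [mem_filter] at hb
          have : 0 < #{i ∈ A | r i b} := card_pos.2 ⟨i, by simp [hi, hb.2]⟩
          have := hcon i hi b hb.1 hb.2
          gcongr
      _ = ∑ b ∈ B, ∑ i ∈ A with r i b, (#{i ∈ A | r i b} : ℚ)⁻¹ := by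
          refine sum_comm' fun i b => ?_
          simp only [mem_filter]; tauto
      _ ≤ ∑ b ∈ B, 1 := sum_le_sum h2
      _ = #B := by simp
  exact absurd (by exact_mod_cast h3) (not_le.2 h)

open Finset in
/-- **Frankl–Katona theorem**: among more than `#B` subsets of `B`, some `j ≥ 1` of them have
exactly `j - 1` common elements. -/
theorem exists_card_common_add_one_eq_card {ι β : Type*} [DecidableEq ι] [DecidableEq β]
    (r : ι → β → Prop) [∀ i b, Decidable (r i b)] (A : Finset ι) (B : Finset β)
    (h : #B < #A) :
    ∃ I ⊆ A, I.Nonempty ∧ #{b ∈ B | ∀ i ∈ I, r i b} + 1 = #I := by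
  induction hn : #B using Nat.strong_induction_on generalizing A B with
  | _ n ih =>
  by_cases hne : ∀ i ∈ A, ∃ b ∈ B, r i b
  · obtain ⟨j, hj, b, hb, hjb, hlt⟩ := exists_card_filter_lt_card_filter r A B h hne
    have hb' : b ∈ {b ∈ B | r j b} := by simp [hb, hjb]
    have hj' : j ∈ {i ∈ A | r i b} := by simp [hj, hjb]
    have hB' := card_erase_add_one hb'
    have hA' := card_erase_add_one hj'
    have hle : #{b ∈ B | r j b} ≤ #B := card_filter_le _ _
    -- Inside the neighbourhoods of `b` and `j`, adding `j` back to `I` adds exactly one common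
    -- element, `b`.
    obtain ⟨I, hIA, hI, hcard⟩ := ih _ (by omega) ({i ∈ A | r i b}.erase j)
      ({b ∈ B | r j b}.erase b) (by omega) rfl
    have hjI : j ∉ I := fun hj => by simpa using hIA hj
    refine ⟨insert j I, ?_, insert_nonempty _ _, ?_⟩
    · refine insert_subset hj fun i hi => ?_
      have := hIA hi
      simp only [mem_erase, mem_filter] at this
      exact this.2.1
    · rw [card_insert_of_notMem hjI, ← hcard]
      have : {b ∈ B | ∀ i ∈ insert j I, r i b} =
          insert b {c ∈ {b ∈ B | r j b}.erase b | ∀ i ∈ I, r i c} := by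
        ext c
        have hIb : ∀ i ∈ I, r i b := fun i hi => by
          have := hIA hi
          simp only [mem_erase, mem_filter] at this
          exact this.2.2
        simp only [mem_filter, mem_insert, mem_erase]
        by_cases hc : c = b
        · subst hc; simp [hb, hjb]; exact hIb
        · simp [hc, and_assoc]
      rw [this, card_insert_of_notMem (by simp)]
  · push Not at hne
    obtain ⟨i, hi, hib⟩ := hne
    refine ⟨{i}, by simpa using hi, singleton_nonempty _, ?_⟩
    rw [filter_false_of_mem (by simpa using hib)]
    simp

/-! ### Intersection-closed families -/

open Finset in
/-- An intersection-closed family of proper subsets of a `2m`-element set none of which has size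
`0` or `m` does not cover all `(m - 1)`-element sets. -/
theorem exists_card_eq_forall_not_subset {ι : Type*} [Fintype ι] [DecidableEq ι] {m : ℕ}
    (hι : Fintype.card ι = 2 * m) (hm : 1 ≤ m) (𝒥 : Finset (Finset ι))
    (huniv : univ ∉ 𝒥) (hempty : ∅ ∉ 𝒥) (hcard : ∀ J ∈ 𝒥, #J ≠ m)
    (hinter : ∀ A ∈ 𝒥, ∀ B ∈ 𝒥, A ∩ B ∈ 𝒥) :
    ∃ X : Finset ι, #X = m - 1 ∧ ∀ J ∈ 𝒥, ¬ X ⊆ J := by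
  by_contra! hcov
  have hcov' : ∀ X : Finset ι, #X ≤ m - 1 → ∃ J ∈ 𝒥, X ⊆ J := by
    intro X hX
    obtain ⟨Y, hXY, -, hY⟩ := exists_subsuperset_card_eq (subset_univ X) hX
      (by rw [card_univ]; omega)
    obtain ⟨J, hJ, hYJ⟩ := hcov Y hY
    exact ⟨J, hJ, hXY.trans hYJ⟩
  have hinf : ∀ (I : Finset ι) (f : ι → Finset ι), I.Nonempty → (∀ i ∈ I, f i ∈ 𝒥) →
      ({v | ∀ i ∈ I, v ∈ f i} : Finset ι) ∈ 𝒥 := by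
    intro I f hI
    induction hI using Finset.Nonempty.cons_induction with
    | singleton a => intro h; simpa using h
    | cons a s ha hs ih =>
      intro h
      have := hinter _ (h a (by simp)) _ (ih fun i hi => h i (by simp [hi]))
      convert this using 1
      ext v; simp
  have hne : 𝒥.Nonempty := let ⟨J, hJ, _⟩ := hcov' ∅ (by simp); ⟨J, hJ⟩
  have hall : 𝒥.inf' hne id ∈ 𝒥 := inf'_mem (𝒥 : Set (Finset ι)) (fun A hA B hB => hinter A hA B hB)
    _ _ _ (fun J hJ => hJ)
  obtain ⟨x, hx⟩ : (𝒥.inf' hne id).Nonempty := by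
    rw [nonempty_iff_ne_empty]; rintro h; rw [h] at hall; exact hempty hall
  have hx : ∀ J ∈ 𝒥, x ∈ J := fun J hJ => (inf'_le id hJ : 𝒥.inf' hne id ≤ J) hx
  -- By minimality, each `i ∈ X` has a member of `𝒥` that meets `X` in exactly `X.erase i`.
  obtain ⟨X, hX⟩ := ({X | x ∉ X ∧ ∀ J ∈ 𝒥, ¬ X ⊆ J} : Set (Finset ι)).toFinite.exists_minimal
    ⟨univ.erase x, by simp, fun J hJ hsub => huniv <| by
      have : J = univ := by
        rw [eq_univ_iff_forall]
        intro v
        by_cases hv : v = x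
        · exact hv ▸ hx J hJ
        · exact hsub (by simp [hv])
      exact this ▸ hJ⟩
  have hXx : x ∉ X := hX.prop.1
  have hXcov : ∀ i ∈ X, ∃ J ∈ 𝒥, X.erase i ⊆ J ∧ i ∉ J := by
    intro i hi
    have hnot := hX.not_prop_of_lt (erase_ssubset hi)
    simp only [Set.mem_ofPred_eq, not_and, not_forall, not_not] at hnot
    obtain ⟨J, hJ, hsub⟩ := hnot (fun h => hXx (mem_of_mem_erase h))
    refine ⟨J, hJ, hsub, fun hiJ => hX.prop.2 J hJ fun v hv => ?_⟩
    by_cases hvi : v = i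
    · exact hvi ▸ hiJ
    · exact hsub (by simp [hv, hvi])
  have hmX : m ≤ #X := by
    by_contra hlt
    obtain ⟨J, hJ, hsub⟩ := hcov' X (by omega)
    exact hX.prop.2 J hJ hsub
  obtain ⟨A, hAX, hA⟩ := exists_subset_card_eq hmX
  choose! F hF hFsub hFnot using hXcov
  have hxA : x ∉ A := fun h => hXx (hAX h)
  have hB : #(insert x A)ᶜ + 1 + m = 2 * m := by
    have := card_compl_add_card (insert x A)
    rw [card_insert_of_notMem hxA, hA, hι] at this
    omega
  obtain ⟨I, hIA, hI, hIc⟩ := exists_card_common_add_one_eq_card (fun i b => b ∈ F i) A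
    (insert x A)ᶜ (by omega)
  refine hcard _ (hinf I F hI fun i hi => hF i (hAX (hIA hi))) ?_
  -- This member of `𝒥` has the forbidden size `1 + (m - #I) + (#I - 1) = m`.
  have key : ({v | ∀ i ∈ I, v ∈ F i} : Finset ι) =
      insert x (A \ I) ∪ {b ∈ (insert x A)ᶜ | ∀ i ∈ I, b ∈ F i} := by
    ext v
    simp only [mem_filter, mem_univ, true_and, mem_union, mem_insert, mem_sdiff, mem_compl,
      not_or]
    constructor
    · intro h
      by_cases hvx : v = x
      · exact Or.inl (Or.inl hvx)
      by_cases hvA : v ∈ A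
      · exact Or.inl (Or.inr ⟨hvA, fun hvI => hFnot v (hAX hvA) (h v hvI)⟩)
      · exact Or.inr ⟨⟨hvx, hvA⟩, h⟩
    · rintro ((rfl | ⟨hvA, hvI⟩) | ⟨-, h⟩)
      · exact fun i hi => hx _ (hF i (hAX (hIA hi)))
      · intro i hi
        refine hFsub i (hAX (hIA hi)) (mem_erase.2 ⟨?_, hAX hvA⟩)
        rintro rfl
        exact hvI hi
      · exact h
  rw [key, card_union_of_disjoint, card_insert_of_notMem (by simp [hxA]),
    card_sdiff_of_subset hIA]
  · have hIc' : #{b ∈ (insert x A)ᶜ | ∀ i ∈ I, b ∈ F i} + 1 = #I := by convert hIc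
    have := card_le_card hIA
    omega
  · rw [disjoint_left]
    intro v hv hv'
    simp only [mem_filter, mem_insert, mem_sdiff, mem_compl, not_or] at hv hv'
    tauto

/-! ### Words and their agreement sets -/

/-- The set of coordinates in which two words agree. -/
def agreeSet {ι V : Type*} [Fintype ι] [DecidableEq V] (f g : ι → V) : Finset ι :=
  Finset.univ.filter fun i => f i = g i

@[simp]
theorem mem_agreeSet {ι V : Type*} [Fintype ι] [DecidableEq V] {f g : ι → V} {i : ι} :
    i ∈ agreeSet f g ↔ f i = g i := by
  simp [agreeSet]

theorem agreeSet_ne_univ {ι V : Type*} [Fintype ι] [DecidableEq V] {f g : ι → V} (h : f ≠ g) :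
    agreeSet f g ≠ Finset.univ := by
  intro huniv
  refine h (funext fun i => ?_)
  rw [← mem_agreeSet, huniv]
  exact Finset.mem_univ i

/-- The word `f` has some word of `ℱ` agreeing with it on `J` and avoiding, off `J`,
any prescribed word. -/
def IsFull {ι V : Type*} (ℱ : Finset (ι → V)) (J : Finset ι) (f : ι → V) : Prop :=
  ∀ h : ι → V, ∃ g ∈ ℱ, (∀ i ∈ J, g i = f i) ∧ ∀ i ∉ J, g i ≠ h i

/-- Choose `g` to follow `f` on `A` and avoid `f` elsewhere, then `h` to follow `f` on `B` and avoid
`g` elsewhere. -/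
theorem exists_agreeSet_eq_inter {ι V : Type*} [Fintype ι] [DecidableEq ι] [DecidableEq V]
    {ℱ : Finset (ι → V)} {A B : Finset ι} {f : ι → V} (hA : IsFull ℱ A f)
    (hB : IsFull ℱ B f) : ∃ g ∈ ℱ, ∃ h ∈ ℱ, agreeSet g h = A ∩ B := by
  obtain ⟨g, hg, hgA, hgf⟩ := hA f
  obtain ⟨h, hh, hhB, hhg⟩ := hB g
  refine ⟨g, hg, h, hh, ?_⟩
  ext i
  rw [mem_agreeSet, Finset.mem_inter]
  by_cases hiB : i ∈ B
  · rw [hhB i hiB]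
    exact ⟨fun h => ⟨by_contra fun hiA => hgf i hiA h, hiB⟩, fun h => hgA i h.1⟩
  · exact ⟨fun h => absurd h.symm (hhg i hiB), fun h => absurd h.2 hiB⟩

open Finset in
open Classical in
/-- The words for which `A` is not full split into few classes in which `A` is no longer an
agreement set. -/
theorem card_filter_not_isFull_le {ι V : Type*} [Fintype ι]
    {ℱ : Finset (ι → V)} {𝒥 : Finset (Finset ι)}
    (h𝒥 : ∀ f ∈ ℱ, ∀ g ∈ ℱ, f ≠ g → agreeSet f g ∈ 𝒥) (A : Finset ι) {N : ℕ}
    (hN : ∀ 𝒢 : Finset (ι → V), (∀ f ∈ 𝒢, ∀ g ∈ 𝒢, f ≠ g → agreeSet f g ∈ 𝒥.erase A) → #𝒢 ≤ N) :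
    #{f ∈ ℱ | ¬ IsFull ℱ A f} ≤ Fintype.card ι * N := by
  obtain rfl | hℱ := ℱ.eq_empty_or_nonempty
  · simp
  -- The blocking word depends only on the restriction `p` to `A`. Hence two words that agree on `A`
  -- and are blocked at the same `i ∉ A` also agree at `i`.
  have hex : ∀ p : A → V, ∃ h : ι → V, (∃ f ∈ ℱ, ¬ IsFull ℱ A f ∧ (fun i : A => f i) = p) →
      ∀ g ∈ ℱ, (fun i : A => g i) = p → ∃ i ∉ A, g i = h i := by
    intro p
    by_cases hp : ∃ f ∈ ℱ, ¬ IsFull ℱ A f ∧ (fun i : A => f i) = p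
    · obtain ⟨f, hf, hfull, rfl⟩ := hp
      unfold IsFull at hfull
      push Not at hfull
      obtain ⟨h, hh⟩ := hfull
      exact ⟨h, fun _ g hg hgf => hh g hg fun i hi => congr_fun hgf ⟨i, hi⟩⟩
    · exact ⟨hℱ.choose, fun h => absurd h hp⟩
  choose H hH using hex
  have hsub : {f ∈ ℱ | ¬ IsFull ℱ A f} ⊆ univ.biUnion fun i : ι =>
      {f ∈ ℱ | i ∉ A ∧ f i = H (fun j : A => f j) i} := by
    intro f hf
    rw [mem_filter] at hf
    obtain ⟨i, hi, hfi⟩ := hH _ ⟨f, hf.1, hf.2, rfl⟩ f hf.1 rfl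
    simp only [mem_biUnion, mem_univ, true_and, mem_filter]
    exact ⟨i, hf.1, hi, hfi⟩
  refine (card_le_card hsub).trans (card_biUnion_le_card_mul _ _ _ fun i _ => hN _ ?_)
  intro f hf g hg hfg
  rw [mem_filter] at hf hg
  refine mem_erase.2 ⟨?_, h𝒥 f hf.1 g hg.1 hfg⟩
  rintro hA
  refine hf.2.1 (hA ▸ mem_agreeSet.2 ?_)
  rw [hf.2.2, hg.2.2]
  congr 1
  funext j
  exact mem_agreeSet.1 (hA ▸ j.2)

open Finset in
open Classical in
/-- A set of words of length `2m` in which no two distinct words agree in exactly `0` or `m`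
coordinates has size `O(n ^ (m - 1))`, where `n` is the size of the alphabet. -/
theorem exists_card_le_of_agreeSet_mem {ι : Type*} [Fintype ι] {m : ℕ}
    (hι : Fintype.card ι = 2 * m) (hm : 1 ≤ m) (𝒥 : Finset (Finset ι))
    (huniv : univ ∉ 𝒥) (hempty : ∅ ∉ 𝒥) (hcard : ∀ J ∈ 𝒥, #J ≠ m) :
    ∃ C : ℕ, ∀ (V : Type u) [Fintype V] (ℱ : Finset (ι → V)),
      (∀ f ∈ ℱ, ∀ g ∈ ℱ, f ≠ g → agreeSet f g ∈ 𝒥) → #ℱ ≤ C * Fintype.card V ^ (m - 1) := by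
  induction 𝒥 using Finset.strongInduction with
  | H 𝒥 ih =>
  by_cases hinter : ∀ A ∈ 𝒥, ∀ B ∈ 𝒥, A ∩ B ∈ 𝒥
  · obtain ⟨X, hX, hXcov⟩ :=
      exists_card_eq_forall_not_subset hι hm 𝒥 huniv hempty hcard hinter
    refine ⟨1, fun V _ ℱ hℱ => ?_⟩
    have hinj : Set.InjOn (fun (f : ι → V) (i : X) => f i) ℱ := by
      intro f hf g hg hfg
      by_contra hne
      exact hXcov _ (hℱ f hf g hg hne) fun i hi => mem_agreeSet.2 (congr_fun hfg ⟨i, hi⟩)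
    have := card_le_card_of_injOn _ (fun f _ => mem_univ _) hinj
    simpa [hX] using this
  · push Not at hinter
    obtain ⟨A, hA, B, hB, hAB⟩ := hinter
    have step : ∀ J ∈ 𝒥, ∃ C : ℕ, ∀ (V : Type u) [Fintype V] (ℱ : Finset (ι → V)),
        (∀ f ∈ ℱ, ∀ g ∈ ℱ, f ≠ g → agreeSet f g ∈ 𝒥.erase J) →
          #ℱ ≤ C * Fintype.card V ^ (m - 1) := fun J hJ =>
      ih _ (erase_ssubset hJ) (fun h => huniv (mem_of_mem_erase h))
        (fun h => hempty (mem_of_mem_erase h)) fun K hK => hcard K (mem_of_mem_erase hK)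
    obtain ⟨CA, hCA⟩ := step A hA
    obtain ⟨CB, hCB⟩ := step B hB
    refine ⟨Fintype.card ι * CA + Fintype.card ι * CB, fun V _ ℱ hℱ => ?_⟩
    have hsub : ℱ ⊆ {f ∈ ℱ | ¬ IsFull ℱ A f} ∪ {f ∈ ℱ | ¬ IsFull ℱ B f} := by
      intro f hf
      by_contra hcon
      simp only [mem_union, mem_filter, hf, true_and, not_or, not_not] at hcon
      obtain ⟨g, hg, h, hh, hgh⟩ := exists_agreeSet_eq_inter hcon.1 hcon.2
      by_cases hne : g = h
      · subst hne
        have : A = univ := by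
          rw [eq_univ_iff_forall]
          intro i
          have : i ∈ agreeSet g g := by simp
          rw [hgh] at this
          exact mem_of_mem_inter_left this
        exact huniv (this ▸ hA)
      · exact hAB (hgh ▸ hℱ g hg h hh hne)
    calc #ℱ ≤ #{f ∈ ℱ | ¬ IsFull ℱ A f} + #{f ∈ ℱ | ¬ IsFull ℱ B f} :=
          (card_le_card hsub).trans (card_union_le _ _)
      _ ≤ Fintype.card ι * (CA * Fintype.card V ^ (m - 1)) +
          Fintype.card ι * (CB * Fintype.card V ^ (m - 1)) :=
          add_le_add (card_filter_not_isFull_le hℱ A (hCA V))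
            (card_filter_not_isFull_le hℱ B (hCB V))
      _ = _ := by ring

/-! ### From set families to words -/

open Finset in
open Classical in
/-- At least a `k ^ (-k)` proportion of all colourings with `k` colours is injective on a given
`k`-element set. -/
theorem pow_card_le_mul_card_injOn {V : Type*} [Fintype V] {k : ℕ} {e : Finset V} (he : #e = k) :
    k ^ Fintype.card V ≤ k ^ k * #{χ : V → Fin k | Set.InjOn χ e} := by
  let φ : e ≃ Fin k := e.equivFinOfCardEq he
  -- Recolouring `e` by a fixed bijection forgets only the colours on `e`, so fibres have at most `k
  -- ^ k` elements.
  let T : (V → Fin k) → V → Fin k := fun χ v => if h : v ∈ e then φ ⟨v, h⟩ else χ v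
  have hT : ∀ χ ∈ (univ : Finset (V → Fin k)),
      T χ ∈ ({χ : V → Fin k | Set.InjOn χ e} : Finset (V → Fin k)) := by
    intro χ _
    rw [mem_filter]
    refine ⟨mem_univ _, fun v hv w hw hvw => ?_⟩
    rw [mem_coe] at hv hw
    simpa [T, hv, hw] using hvw
  have := card_le_mul_card_image_of_maps_to hT (k ^ k) fun ψ _ => ?_
  · simpa using this
  · have hinj : Set.InjOn (fun (χ : V → Fin k) (v : e) => χ v)
        ({χ ∈ univ | T χ = ψ} : Finset (V → Fin k)) := by
      intro χ hχ χ' hχ' h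
      simp only [coe_filter, mem_univ, true_and, Set.mem_ofPred_eq] at hχ hχ'
      funext v
      by_cases hv : v ∈ e
      · exact congr_fun h ⟨v, hv⟩
      · have := congr_fun (hχ.trans hχ'.symm) v
        simpa [T, hv] using this
    have := card_le_card_of_injOn _ (fun χ _ => mem_univ _) hinj
    simpa [he] using this

open Finset in
open Classical in
/-- Every family of `k`-element sets has a colouring of the vertices with `k` colours for which at
least a `k ^ (-k)` proportion of its members is rainbow. -/
theorem exists_card_le_mul_card_rainbow {V : Type*} [Fintype V] {k : ℕ} (hk : 0 < k)
    (E : Finset (Finset V)) (hE : ∀ e ∈ E, #e = k) :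
    ∃ χ : V → Fin k, #E ≤ k ^ k * #(E.filter fun e : Finset V => Set.InjOn χ e) := by
  by_contra! hcon
  have : Nonempty (V → Fin k) := ⟨fun _ => ⟨0, hk⟩⟩
  have h1 : ∑ χ : V → Fin k, k ^ k * #(E.filter fun e : Finset V => Set.InjOn χ e) < ∑ χ : V → Fin k, #E :=
    sum_lt_sum_of_nonempty univ_nonempty fun χ _ => hcon χ
  have h2 : ∑ e ∈ E, k ^ Fintype.card V ≤
      ∑ e ∈ E, k ^ k * #{χ : V → Fin k | Set.InjOn χ e} :=
    sum_le_sum fun e he => pow_card_le_mul_card_injOn (hE e he)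
  rw [← mul_sum] at h1 h2
  have h3 := sum_card_bipartiteAbove_eq_sum_card_bipartiteBelow (s := E)
    (t := (univ : Finset (V → Fin k))) fun (e : Finset V) (χ : V → Fin k) => Set.InjOn χ e
  simp only [bipartiteAbove, bipartiteBelow] at h3
  rw [h3] at h2
  simp only [sum_const, smul_eq_mul, card_univ, Fintype.card_pi, Fintype.card_fin,
    prod_const] at h1 h2
  rw [mul_comm] at h2
  exact absurd h1 (not_lt.2 h2)

open Finset in
open Classical in
/-- A family of `2m`-element subsets of an `n`-element set no two of which meet in exactly `0` or
`m` elements has size `O(n ^ (m - 1))`. -/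
theorem exists_card_le_of_card_inter_ne {m : ℕ} (hm : 1 ≤ m) :
    ∃ C : ℕ, ∀ (V : Type u) [Fintype V] (E : Finset (Finset V)), (∀ e ∈ E, #e = 2 * m) →
      (∀ e₁ ∈ E, ∀ e₂ ∈ E, e₁ ≠ e₂ → #(e₁ ∩ e₂) ≠ 0 ∧ #(e₁ ∩ e₂) ≠ m) →
      #E ≤ C * Fintype.card V ^ (m - 1) := by
  obtain ⟨C, hC⟩ := exists_card_le_of_agreeSet_mem.{u} (ι := Fin (2 * m)) (Fintype.card_fin _) hm
    {J | J ≠ univ ∧ #J ≠ 0 ∧ #J ≠ m} (by simp) (by simp) (by simp +contextual)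
  refine ⟨(2 * m) ^ (2 * m) * C, fun V _ E hE hEE => ?_⟩
  obtain hV | hV := isEmpty_or_nonempty V
  · have : E = ∅ := eq_empty_of_forall_notMem fun e he => by
      have := hE e he
      rw [eq_empty_of_isEmpty e, card_empty] at this
      omega
    simp [this]
  obtain ⟨χ, hχ⟩ := exists_card_le_mul_card_rainbow (by omega) E hE
  set R := E.filter fun e : Finset V => Set.InjOn χ e with hR
  -- Coordinate `i` holds the vertex of `e` coloured `i`, so a common vertex occupies the same
  -- coordinate in both words.
  have hword : ∀ e ∈ R, ∃ f : Fin (2 * m) → V, ∀ i, f i ∈ e ∧ χ (f i) = i := by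
    intro e he
    rw [hR, mem_filter] at he
    have himage : e.image χ = univ := eq_univ_of_card _ <| by
      rw [card_image_of_injOn he.2, hE e he.1, Fintype.card_fin]
    have : ∀ i, ∃ v, v ∈ e ∧ χ v = i := fun i => mem_image.1 (himage ▸ mem_univ i)
    exact Classical.skolem.1 this
  choose! w hwmem hwχ using hword
  have hwinv : ∀ e ∈ R, ∀ v ∈ e, w e (χ v) = v := fun e he v hv =>
    (mem_filter.1 he).2 (hwmem e he _) hv (hwχ e he _)
  have hagree : ∀ e₁ ∈ R, ∀ e₂ ∈ R, #(agreeSet (w e₁) (w e₂)) = #(e₁ ∩ e₂) := by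
    intro e₁ h₁ e₂ h₂
    have : e₁ ∩ e₂ = (agreeSet (w e₁) (w e₂)).image (w e₁) := by
      ext v
      simp only [mem_inter, mem_image, mem_agreeSet]
      constructor
      · rintro ⟨hv₁, hv₂⟩
        exact ⟨χ v, by rw [hwinv e₁ h₁ v hv₁, hwinv e₂ h₂ v hv₂], hwinv e₁ h₁ v hv₁⟩
      · rintro ⟨i, hi, rfl⟩
        exact ⟨hwmem e₁ h₁ i, hi ▸ hwmem e₂ h₂ i⟩
    rw [this, card_image_of_injective]
    exact Function.LeftInverse.injective (hwχ e₁ h₁)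
  have hinj : Set.InjOn w R := by
    intro e₁ h₁ e₂ h₂ h
    ext v
    exact ⟨fun hv => by have := hwmem e₂ h₂ (χ v); rwa [← h, hwinv e₁ h₁ v hv] at this,
      fun hv => by have := hwmem e₁ h₁ (χ v); rwa [h, hwinv e₂ h₂ v hv] at this⟩
  have hcard : #R ≤ C * Fintype.card V ^ (m - 1) := by
    rw [← card_image_of_injOn hinj]
    refine hC V _ ?_
    simp only [forall_mem_image]
    intro e₁ h₁ e₂ h₂ hne
    rw [mem_filter]
    refine ⟨mem_univ _, agreeSet_ne_univ hne, ?_⟩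
    rw [hagree e₁ h₁ e₂ h₂]
    exact hEE e₁ (mem_filter.1 h₁).1 e₂ (mem_filter.1 h₂).1 fun h => hne (h ▸ rfl)
  calc #E ≤ (2 * m) ^ (2 * m) * #R := hχ
    _ ≤ (2 * m) ^ (2 * m) * (C * Fintype.card V ^ (m - 1)) := Nat.mul_le_mul_left _ hcard
    _ = _ := by ring

theorem lemma1p7 (k : ℕ) (hk : 4 ≤ k) (hk_even : Even k) :
    ∃ c : ℝ, 0 < c ∧
      ∀ (α : Type*) (H : Hypergraph α) (n : ℕ), 1 ≤ n → H.vertexSet.encard = n → H.IsKGraph k →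
        (∀ e₁ ∈ H.edgeSet, ∀ e₂ ∈ H.edgeSet, e₁ ≠ e₂ →
          (e₁ ∩ e₂).ncard ≠ 0 ∧ (e₁ ∩ e₂).ncard ≠ k / 2) →
        (H.edgeSet.ncard : ℝ) < c * (n : ℝ) ^ (k / 2 - 1) := by
  classical
  obtain ⟨m, rfl⟩ := hk_even.two_dvd
  obtain ⟨C, hC⟩ := exists_card_le_of_card_inter_ne (m := m) (by omega)
  -- The extra 1 makes the bound strict, since `n ≥ 1`.
  refine ⟨C + 1, by positivity, fun α H n hn hV hH hinter => ?_⟩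
  rw [Nat.mul_div_cancel_left m two_pos] at hinter ⊢
  have hfin : H.vertexSet.Finite := Set.finite_of_encard_eq_coe hV
  have : Fintype H.vertexSet := hfin.fintype
  have hcardV : Fintype.card H.vertexSet = n := by
    rw [← Nat.card_eq_fintype_card, Nat.card_coe_set_eq, Set.ncard, hV, ENat.toNat_natCast]
  let ψ : Finset H.vertexSet → Set α := fun e => Subtype.val '' (e : Set H.vertexSet)
  have hψinj : Function.Injective ψ := fun e₁ e₂ h =>
    Finset.coe_injective (Subtype.val_injective.image_injective h)
  have hψcard : ∀ e, (ψ e).ncard = e.card := fun e => by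
    rw [Set.ncard_image_of_injective _ Subtype.val_injective, Set.ncard_coe_finset]
  have hψinter : ∀ e₁ e₂, ψ e₁ ∩ ψ e₂ = ψ (e₁ ∩ e₂) := fun e₁ e₂ => by
    simp only [ψ, Finset.coe_inter, Set.image_inter Subtype.val_injective]
  let E : Finset (Finset H.vertexSet) := Finset.univ.filter fun e => ψ e ∈ H.edgeSet
  have hE : ∀ e ∈ E, ψ e ∈ H.edgeSet := fun e he => (Finset.mem_filter.1 he).2
  have hEdge : H.edgeSet = ψ '' E := by
    ext s
    constructor
    · intro hs
      have hsV := H.subset_vertexSet_of_mem_edgeSet' hs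
      have hψs : ψ (Subtype.val ⁻¹' s : Set H.vertexSet).toFinset = s := by
        simp only [ψ, Set.coe_toFinset, Subtype.image_preimage_coe]
        exact Set.inter_eq_right.2 hsV
      exact ⟨_, Finset.mem_filter.2 ⟨Finset.mem_univ _, hψs.symm ▸ hs⟩, hψs⟩
    · rintro ⟨e, he, rfl⟩
      exact hE e he
  have hbound : E.card ≤ C * n ^ (m - 1) := by
    rw [← hcardV]
    refine hC _ E (fun e he => ?_) fun e₁ h₁ e₂ h₂ hne => ?_
    · rw [← hψcard, Set.ncard, hH _ (hE e he), ENat.toNat_natCast]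
    · have := hinter _ (hE e₁ h₁) _ (hE e₂ h₂) (hψinj.ne hne)
      rw [hψinter, hψcard] at this
      convert this
  rw [hEdge, Set.ncard_image_of_injective _ hψinj, Set.ncard_coe_finset]
  have hpos : (0 : ℝ) < (n : ℝ) ^ (m - 1) := by positivity
  have : (E.card : ℝ) ≤ C * (n : ℝ) ^ (m - 1) := by exact_mod_cast hbound
  linarith
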